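/- For a set $I$ of positive real numbers let $\langle I\rangle$ be the additive submonoid of $\mathbb{R}_{\ge 0}$ generated by $I$, and put $S(I)=\langle I\rangle\cap\mathbb{N}$, where $\mathbb{N}=\{0,1,2,\dots\}$. Let $a,b$ be integers with $2\le a<b$, and let $H=S\big(\,]\tfrac{b}{a},\tfrac{b}{a-1}[\,\big)$ be the semigroup associated with the open interval from $\tfrac ba$ to $\tfrac b{a-1}$. Then $H$ is a numerical semigroup (a submonoid of $\mathbb{N}$ with finite complement), the set $$\Big\{k\in\{1,2,\dots,a-1\}\;\Big|\;(kb \bmod a)+\Big\lfloor\frac{kb}{a}\Big\rfloor>a-1\Big\}$$ is non-empty, and, if $\delta$ denotes its least element, the multiplicity $\mathrm{m}(H)$ of $H$ (the smallest element of its minimal system of generators) is $$\mathrm{m}(H)=\Big\lfloor\frac{\delta b}{a}\Big\rfloor+1.$$ -/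

import Mathlib

/-- A numerical semigroup: a submonoid of `ℕ` whose set of gaps `ℕ \ H` is finite. -/
def IsNumericalSemigroup (H : AddSubmonoid ℕ) : Prop :=
  ((H : Set ℕ)ᶜ).Finite

/-- `A` is a minimal system of generators of `H`: it generates `H` and no proper subset
of it does. -/
def IsMinimalGenerators (H : AddSubmonoid ℕ) (A : Set ℕ) : Prop :=
  Minimal (fun B : Set ℕ => AddSubmonoid.closure B = H) A

/-- `m` is the multiplicity of `H`: the smallest element of the minimal system of generators
of `H`. (A submonoid of `ℕ` has exactly one minimal system of generators; the definition asks
that there is one and that `m` is the least element of each.) -/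
def IsMultiplicity (H : AddSubmonoid ℕ) (m : ℕ) : Prop :=
  (∃ A, IsMinimalGenerators H A) ∧ ∀ A, IsMinimalGenerators H A → IsLeast A m

/-- `S(I) = ⟨I⟩ ∩ ℕ`, where `⟨I⟩` is the additive submonoid of the reals generated by `I`. -/
noncomputable def intervalSemigroup (I : Set ℝ) : AddSubmonoid ℕ :=
  (AddSubmonoid.closure I).comap (Nat.castAddMonoidHom ℝ)

/-- The `k ∈ {1, …, a - 1}` with `(kb mod a) + ⌊kb/a⌋ c > (c - 1) b + a - c`
(the inequality is read in the integers). -/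
def delgadoRosalesSet (a b c : ℕ) : Set ℕ :=
  {k | k ∈ Finset.Icc 1 (a - 1) ∧
    (((k * b) % a : ℕ) : ℤ) + ⌊((k : ℚ) * b) / a⌋ * (c : ℤ) > ((c : ℤ) - 1) * b + a - c}

/-! A sum of `k` elements of an open interval `]l, u[` is any point of `]kl, ku[`, so a nonzero `n`
lies in `H` iff `kb/a < n < kb/(a-1)` for some `k ≥ 1` (`mem_intervalSemigroup_iff`). For given `k`
such an `n` exists iff `⌊kb/a⌋ + 1` is one, which is the inequality defining the set. As `⌊kb/a⌋`
grows with `k`, the least admissible `k` gives the least nonzero element of `H`, and this is the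
multiplicity. -/

/-- The nonzero elements of `H` that are not a sum of two nonzero elements of `H`. -/
def AddSubmonoid.irreducibles (H : AddSubmonoid ℕ) : Set ℕ :=
  {x | x ∈ H ∧ x ≠ 0 ∧ ∀ y ∈ H, ∀ z ∈ H, y + z = x → y = 0 ∨ z = 0}

theorem AddSubmonoid.irreducibles_subset_of_closure_eq {H : AddSubmonoid ℕ} {B : Set ℕ}
    (hB : AddSubmonoid.closure B = H) : H.irreducibles ⊆ B := by
  intro x hx
  have key : ∀ y ∈ AddSubmonoid.closure B, y ∈ H.irreducibles → y ∈ B := by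
    intro y hy
    induction hy using AddSubmonoid.closure_induction with
    | mem y hy => exact fun _ => hy
    | zero => exact fun h => absurd rfl h.2.1
    | add y z hy hz ihy ihz =>
      intro h
      rcases h.2.2 y (hB ▸ hy) z (hB ▸ hz) rfl with rfl | rfl
      · rw [zero_add] at h ⊢
        exact ihz h
      · rw [add_zero] at h ⊢
        exact ihy h
  exact key x (hB.symm ▸ hx.1) hx

theorem AddSubmonoid.closure_irreducibles (H : AddSubmonoid ℕ) :
    AddSubmonoid.closure H.irreducibles = H := by
  apply le_antisymm
  · exact AddSubmonoid.closure_le.2 fun x hx => hx.1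
  · intro x
    induction x using Nat.strong_induction_on with
    | _ x ih =>
      intro hx
      by_cases hirr : x ∈ H.irreducibles
      · exact AddSubmonoid.subset_closure hirr
      by_cases h0 : x = 0
      · exact h0 ▸ zero_mem _
      have : ∃ y ∈ H, ∃ z ∈ H, y + z = x ∧ y ≠ 0 ∧ z ≠ 0 := by
        by_contra! hcon
        refine hirr ⟨hx, h0, fun y hy z hz hyz => ?_⟩
        by_cases hy0 : y = 0
        · exact Or.inl hy0
        · exact Or.inr (hcon y hy z hz hyz hy0)
      obtain ⟨y, hy, z, hz, hyz, hy0, hz0⟩ := this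
      rw [← hyz]
      exact add_mem (ih y (by omega) hy) (ih z (by omega) hz)

theorem isMinimalGenerators_iff {H : AddSubmonoid ℕ} {A : Set ℕ} :
    IsMinimalGenerators H A ↔ A = H.irreducibles := by
  constructor
  · intro h
    have hsub := AddSubmonoid.irreducibles_subset_of_closure_eq h.1
    exact (h.2 H.closure_irreducibles hsub).antisymm hsub
  · rintro rfl
    exact ⟨H.closure_irreducibles, fun B hB _ =>
      AddSubmonoid.irreducibles_subset_of_closure_eq hB⟩

/-- The irreducibles are the only minimal system of generators, and a sum of two nonzero elements is
at least `2m > m`, so `m` is irreducible. -/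
theorem isMultiplicity_of_isLeast {H : AddSubmonoid ℕ} {m : ℕ}
    (hm : IsLeast {n | n ∈ H ∧ n ≠ 0} m) : IsMultiplicity H m := by
  refine ⟨⟨_, isMinimalGenerators_iff.2 rfl⟩, fun A hA => ?_⟩
  rw [isMinimalGenerators_iff.1 hA]
  refine ⟨⟨hm.1.1, hm.1.2, fun y hy z hz hyz => ?_⟩, fun x hx => hm.2 ⟨hx.1, hx.2.1⟩⟩
  by_contra! hne
  have h1 : m ≤ y := hm.2 ⟨hy, hne.1⟩
  have h2 := hne.2
  omega

theorem mem_closure_Ioo_iff {l u x : ℝ} :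
    x ∈ AddSubmonoid.closure (Set.Ioo l u) ↔
      x = 0 ∨ ∃ k : ℕ, 0 < k ∧ k * l < x ∧ x < k * u := by
  constructor
  · intro hx
    induction hx using AddSubmonoid.closure_induction with
    | mem x hx => exact Or.inr ⟨1, one_pos, by simpa using hx.1, by simpa using hx.2⟩
    | zero => exact Or.inl rfl
    | add x y _ _ ihx ihy =>
      rcases ihx with rfl | ⟨k, hk, hkl, hku⟩
      · simpa using ihy
      rcases ihy with rfl | ⟨j, hj, hjl, hju⟩
      · exact Or.inr ⟨k, hk, by simpa using hkl, by simpa using hku⟩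
      · refine Or.inr ⟨k + j, by omega, ?_, ?_⟩ <;> push_cast <;> linarith
  · rintro (rfl | ⟨k, hk, hl, hu⟩)
    · exact zero_mem _
    · have hk' : (0 : ℝ) < k := by exact_mod_cast hk
      have hmem : x / k ∈ Set.Ioo l u := by
        constructor
        · rw [lt_div_iff₀ hk']; linarith
        · rw [div_lt_iff₀ hk']; linarith
      -- Here `x` is the sum of `k` copies of `x / k`.
      have := nsmul_mem (AddSubmonoid.subset_closure hmem) k
      rwa [nsmul_eq_mul, mul_div_cancel₀ _ hk'.ne'] at this

theorem mem_intervalSemigroup_iff {a b n : ℕ} (ha : 2 ≤ a) :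
    n ∈ intervalSemigroup (Set.Ioo ((b : ℝ) / a) ((b : ℝ) / ((a : ℝ) - 1))) ↔
      n = 0 ∨ ∃ k : ℕ, 0 < k ∧ k * b < n * a ∧ n * a < k * b + n := by
  have ha' : (2 : ℝ) ≤ a := by exact_mod_cast ha
  have ha0 : (0 : ℝ) < a := by linarith
  have ha1 : (0 : ℝ) < (a : ℝ) - 1 := by linarith
  have h : n ∈ intervalSemigroup (Set.Ioo ((b : ℝ) / a) ((b : ℝ) / ((a : ℝ) - 1))) ↔
      (n : ℝ) ∈ AddSubmonoid.closure (Set.Ioo ((b : ℝ) / a) ((b : ℝ) / ((a : ℝ) - 1))) :=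
    Iff.rfl
  rw [h, mem_closure_Ioo_iff, Nat.cast_eq_zero]
  refine or_congr Iff.rfl (exists_congr fun k => and_congr Iff.rfl (and_congr ?_ ?_))
  · rw [← mul_div_assoc, div_lt_iff₀ ha0]
    exact_mod_cast Iff.rfl
  · rw [← mul_div_assoc, lt_div_iff₀ ha1, mul_sub, mul_one, sub_lt_iff_lt_add]
    exact_mod_cast Iff.rfl

theorem mem_delgadoRosalesSet_one_iff {a b k : ℕ} :
    k ∈ delgadoRosalesSet a b 1 ↔
      (1 ≤ k ∧ k ≤ a - 1) ∧ a ≤ k * b % a + k * b / a := by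
  have h : ⌊((k : ℚ) * b) / a⌋ = ((k * b / a : ℕ) : ℤ) := by
    have := Rat.floor_intCast_div_natCast ((k * b : ℕ) : ℤ) a
    push_cast at this ⊢
    exact this
  unfold delgadoRosalesSet
  rw [Set.mem_ofPred_eq, h, Finset.mem_Icc]
  refine and_congr Iff.rfl ?_
  generalize k * b % a = r
  generalize k * b / a = q
  rw [Nat.cast_one, mul_one, sub_self, zero_mul]
  omega

/-- The least integer above `k b / a` lies below `k b / (a - 1)` exactly when the
Delgado–Rosales inequality holds for `k`. -/
theorem succ_div_mul_lt_iff {a b k : ℕ} :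
    (k * b / a + 1) * a < k * b + (k * b / a + 1) ↔ a ≤ k * b % a + k * b / a := by
  have h := Nat.mod_add_div (k * b) a
  have : (k * b / a + 1) * a = a * (k * b / a) + a := by ring
  omega

/-- The upper bound reads `n(a-1) < kb`, so it passes down from `n` to the least integer above
`kb/a`. -/
theorem le_mod_add_div_of_between {a b k n : ℕ} (ha : 2 ≤ a) (h₁ : k * b < n * a)
    (h₂ : n * a < k * b + n) : a ≤ k * b % a + k * b / a := by
  rw [← succ_div_mul_lt_iff]
  have hle : k * b / a + 1 ≤ n := (Nat.div_lt_iff_lt_mul (by omega)).2 h₁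
  obtain ⟨d, hd⟩ := Nat.exists_eq_add_of_le hle
  have hda : d ≤ d * a := Nat.le_mul_of_pos_right d (by omega)
  have : n * a = (k * b / a + 1) * a + d * a := by rw [hd]; ring
  omega

theorem pred_mem_delgadoRosalesSet_one {a b : ℕ} (ha : 2 ≤ a) (hab : a < b) :
    a - 1 ∈ delgadoRosalesSet a b 1 := by
  obtain ⟨c, rfl⟩ := Nat.exists_eq_add_of_le ha
  obtain ⟨d, rfl⟩ := Nat.exists_eq_add_of_lt hab
  refine mem_delgadoRosalesSet_one_iff.2 ⟨by omega, ?_⟩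
  have h : 2 + c - 1 = c + 1 := by omega
  rw [h]
  -- The witness `n` is `b - 1`: the two bounds reduce to `a < b` and `1 < a`.
  apply le_mod_add_div_of_between (n := 2 + c + d) ha <;> nlinarith

theorem isNumericalSemigroup_intervalSemigroup {a b : ℕ} (ha : 2 ≤ a) (hb : 0 < b) :
    IsNumericalSemigroup
      (intervalSemigroup (Set.Ioo ((b : ℝ) / a) ((b : ℝ) / ((a : ℝ) - 1)))) := by
  refine (Set.finite_Iic b).subset fun n hn => ?_
  rw [Set.mem_Iic]
  by_contra! hlt
  -- This is the largest `k` with `kb < na`; then `na ≤ kb + b < kb + n` because `n > b`.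
  refine hn ((mem_intervalSemigroup_iff ha).2 (Or.inr ⟨(n * a - 1) / b, ?_⟩))
  have hna : n * 2 ≤ n * a := Nat.mul_le_mul_left n ha
  have hmod := Nat.mod_lt (n * a - 1) hb
  have hdiv := Nat.div_add_mod' (n * a - 1) b
  exact ⟨Nat.div_pos (by omega) hb, by omega, by omega⟩

theorem mainTheorem4 (a b : ℕ) (ha : 2 ≤ a) (hab : a < b) :
    IsNumericalSemigroup (intervalSemigroup (Set.Ioo ((b : ℝ) / a) ((b : ℝ) / ((a : ℝ) - 1)))) ∧
    ∃ δ : ℕ, IsLeast (delgadoRosalesSet a b 1) δ ∧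
      IsMultiplicity (intervalSemigroup (Set.Ioo ((b : ℝ) / a) ((b : ℝ) / ((a : ℝ) - 1))))
        (⌊((δ : ℚ) * b) / a⌋₊ + 1) := by
  refine ⟨isNumericalSemigroup_intervalSemigroup ha (by omega), ?_⟩
  have hne : (delgadoRosalesSet a b 1).Nonempty := ⟨_, pred_mem_delgadoRosalesSet_one ha hab⟩
  obtain ⟨δ, hδ⟩ : ∃ δ, IsLeast (delgadoRosalesSet a b 1) δ :=
    ⟨_, Nat.sInf_mem hne, fun _ h => Nat.sInf_le h⟩
  refine ⟨δ, hδ, isMultiplicity_of_isLeast ?_⟩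
  have hfloor : ⌊((δ : ℚ) * b) / a⌋₊ = δ * b / a := by
    rw [← Nat.cast_mul, Nat.floor_div_eq_div]
  obtain ⟨⟨hδ1, hδa⟩, hδineq⟩ := mem_delgadoRosalesSet_one_iff.1 hδ.1
  rw [hfloor]
  refine ⟨⟨(mem_intervalSemigroup_iff ha).2 (Or.inr ⟨δ, hδ1, ?_, ?_⟩), by omega⟩, ?_⟩
  · exact Nat.lt_mul_of_div_lt (Nat.lt_succ_self _) (by omega)
  · exact succ_div_mul_lt_iff.2 hδineq
  · rintro n ⟨hn, hn0⟩
    rcases (mem_intervalSemigroup_iff ha).1 hn with h0 | ⟨k, hk, h₁, h₂⟩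
    · exact absurd h0 hn0
    have hle : δ ≤ k := by
      by_cases hka : k ≤ a - 1
      · exact hδ.2 (mem_delgadoRosalesSet_one_iff.2
          ⟨⟨hk, hka⟩, le_mod_add_div_of_between ha h₁ h₂⟩)
      -- For `k ≥ a` the bound `δ ≤ a - 1` suffices.
      · omega
    refine (Nat.div_lt_iff_lt_mul (by omega)).2 (lt_of_le_of_lt ?_ h₁)
    exact Nat.mul_le_mul_right b hle
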